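/- Let $(M,\mathrm{dist})$ be a compact, connected, locally connected metric space with more than one point (equivalently, nonempty and without isolated points), and let $f:M\to M$ be an expansive homeomorphism: there is $\alpha>0$ such that for all $x\ne y$ in $M$ there is $n\in\mathbb Z$ with $\mathrm{dist}(f^n(x),f^n(y))>\alpha$. Call a metric $d$ on $M$ a hyperbolic metric adapted to $f$, with constants $k>1$ and $\varepsilon_0>0$, if $d$ defines the topology of $M$, both $f$ and $f^{-1}$ are Lipschitz for $d$, and $$\max\{d(f(x),f(y)),\,d(f^{-1}(x),f^{-1}(y))\}\ \ge\ \min\{k\,d(x,y),\varepsilon_0\}\qquad\text{for all }x,y\in M.$$ For a metric $d$ on $M$, $x\in M$, $\delta>0$ and $n\in\mathbb N$ put $$B^*_x(\delta,n)=\{y\in M\setminus\{x\}: d(f^j(x),f^j(y))\le\delta\ \text{ for } j=0,\dots,n\},$$ $$A_\delta(x,n)=\sup_{y\in B^*_x(\delta,n)}\frac{d(f^n(x),f^n(y))}{d(x,y)},\qquad a_\delta(x,n)=\inf_{y\in B^*_x(\delta,n)}\frac{d(f^n(x),f^n(y))}{d(x,y)},$$ $$\Lambda^+_\delta(x)=\limsup_{n\to+\infty}\frac1n\log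 A_\delta(x,n),\qquad \lambda^+_\delta(x)=\limsup_{n\to+\infty}\frac1n\log a_\delta(x,n),$$ $$\Lambda^+(x)=\lim_{\delta\to0^+}\Lambda^+_\delta(x),\qquad \lambda^+(x)=\lim_{\delta\to0^+}\lambda^+_\delta(x).$$ Then an adapted hyperbolic metric for $f$ exists. Moreover, for every such metric $d$ with constants $k,\varepsilon_0$, and with $\gamma=\log k>0$, the exponents $\Lambda^+(x)$ and $\lambda^+(x)$ computed with $d$ exist as real numbers at every point $x\in M$ and satisfy $$\Lambda^+(x)\ge\gamma\qquad\text{and}\qquad\lambda^+(x)\le-\gamma .$$ -/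

import Mathlib

open Filter Topology
open scoped ENNReal

/-- A homeomorphism of a metric space is expansive if there is `α > 0` such that any two distinct
points are separated by more than `α` at some time `n ∈ ℤ`. -/
def IsExpansive {M : Type*} [MetricSpace M] (f : M ≃ₜ M) : Prop :=
  ∃ α : ℝ, 0 < α ∧ ∀ x y : M, x ≠ y → ∃ n : ℤ, α < dist ((f ^ n) x) ((f ^ n) y)

/-- `d` is a metric on the set `M` which defines the given topology of `M`. -/
structure IsCompatibleMetric {M : Type*} [TopologicalSpace M] (d : M → M → ℝ) : Prop where
  eq_zero_iff : ∀ x y, d x y = 0 ↔ x = y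
  symm : ∀ x y, d x y = d y x
  triangle : ∀ x y z, d x z ≤ d x y + d y z
  isOpen_iff : ∀ s : Set M, IsOpen s ↔ ∀ x ∈ s, ∃ r : ℝ, 0 < r ∧ ∀ y, d x y < r → y ∈ s

/-- `d` is a hyperbolic metric adapted to the homeomorphism `f`, with expansion constant `k` and
threshold `ε₀`. -/
structure IsHyperbolicMetric {M : Type*} [TopologicalSpace M] (f : M ≃ₜ M) (d : M → M → ℝ)
    (k ε₀ : ℝ) : Prop where
  isCompatibleMetric : IsCompatibleMetric d
  one_lt : 1 < k
  pos : 0 < ε₀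
  hyperbolic : ∀ x y, min (k * d x y) ε₀ ≤ max (d (f x) (f y)) (d (f.symm x) (f.symm y))
  lipschitz : ∃ K : ℝ, ∀ x y, d (f x) (f y) ≤ K * d x y
  lipschitz_symm : ∃ K : ℝ, ∀ x y, d (f.symm x) (f.symm y) ≤ K * d x y

namespace LyapunovExponent

variable {M : Type*} [TopologicalSpace M] (f : M ≃ₜ M) (d : M → M → ℝ)

/-- The punctured dynamical ball `B*_x(δ, n)`, for the metric `d`. -/
def puncturedBall (δ : ℝ) (x : M) (n : ℕ) : Set M :=
  {y | y ≠ x ∧ ∀ j : ℕ, j ≤ n → d ((f ^ j) x) ((f ^ j) y) ≤ δ}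

/-- The maximal distortion `A_δ(x, n)`, a supremum in `[0, ∞]`. -/
noncomputable def maxDistortion (δ : ℝ) (x : M) (n : ℕ) : ℝ≥0∞ :=
  ⨆ y ∈ puncturedBall f d δ x n, ENNReal.ofReal (d ((f ^ n) x) ((f ^ n) y) / d x y)

/-- The minimal distortion `a_δ(x, n)`, an infimum in `[0, ∞]`. -/
noncomputable def minDistortion (δ : ℝ) (x : M) (n : ℕ) : ℝ≥0∞ :=
  ⨅ y ∈ puncturedBall f d δ x n, ENNReal.ofReal (d ((f ^ n) x) ((f ^ n) y) / d x y)

/-- `Λ⁺_δ(x) = limsup (1/n) log A_δ(x, n)` as `n → +∞`, in the extended reals. -/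
noncomputable def maxExponentAtScale (δ : ℝ) (x : M) : EReal :=
  limsup (fun n : ℕ => ENNReal.log (maxDistortion f d δ x n) / (n : EReal)) atTop

/-- `λ⁺_δ(x) = limsup (1/n) log a_δ(x, n)` as `n → +∞`, in the extended reals. -/
noncomputable def minExponentAtScale (δ : ℝ) (x : M) : EReal :=
  limsup (fun n : ℕ => ENNReal.log (minDistortion f d δ x n) / (n : EReal)) atTop

/-- The maximal exponent `Λ⁺(x) = lim_{δ → 0⁺} Λ⁺_δ(x)` exists and is the real number `L`. -/
def HasMaxExponent (x : M) (L : ℝ) : Prop :=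
  Tendsto (fun δ : ℝ => maxExponentAtScale f d δ x) (𝓝[>] 0) (𝓝 (L : EReal))

/-- The minimal exponent `λ⁺(x) = lim_{δ → 0⁺} λ⁺_δ(x)` exists and is the real number `l`. -/
def HasMinExponent (x : M) (l : ℝ) : Prop :=
  Tendsto (fun δ : ℝ => minExponentAtScale f d δ x) (𝓝[>] 0) (𝓝 (l : EReal))

end LyapunovExponent

/-! While the orbits of two points stay closer than the threshold, the distances `u n` between them
satisfy `k * u (n + 1) ≤ max (u (n + 2)) (u n)`. If such a sequence fails to contract once, it grows
geometrically from then on. Hence `f^[n]` contracts local stable sets by `k⁻ⁿ`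
(`IsHyperbolicDist.pow_mul_dist_iterate_le`). A point `y ≠ x` of a local stable set of `x` bounds
the minimal distortion by `k⁻ⁿ`. A point of a local unstable set of `f^[n] x`, pulled back `n`
steps, bounds the maximal one below by `kⁿ`. The exponents are monotone in `δ` and kept finite by
the Lipschitz constants.

The core is that local stable sets are nontrivial at every point
(`IsHyperbolicDist.exists_mem_localStableSet_ne`). If one were trivial, that point would be
recurrent and have a whole ball inside its local unstable set. This propagates over a clopen set,
hence to all of `M`, with a uniform radius `r`. Then any two distinct points end up at distance at
least `r`, which is impossible in an infinite compact space.

For existence, `b ^ n` with `n` the first separation time is a quasi-distance that a power of `f` or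
of its inverse expands. Frink's lemma replaces it by a metric, and a weighted maximum over finitely
many iterates turns expansion by a power into expansion by `f` or `f.symm`. -/

/-! ### Contraction of bounded sequences, and iterates. -/

/-- A bounded nonnegative sequence which is expanded by the factor `k > 1` by at least one of the
two shifts is contracted by the forward shift. -/
theorem mul_succ_le_of_bounded {u : ℕ → ℝ} {k δ : ℝ} (hk : 1 < k) (h0 : ∀ j, 0 ≤ u j)
    (hδ : ∀ j, u j ≤ δ) (hu : ∀ j, k * u (j + 1) ≤ max (u (j + 2)) (u j)) (j : ℕ) :
    k * u (j + 1) ≤ u j := by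
  by_contra! hj
  have hpos : 0 < u (j + 1) := by nlinarith [h0 j, h0 (j + 1)]
  -- If the earlier term does not dominate, the later one must. So the failure passes to the next
  -- index and forces growth by `k`.
  have key : ∀ i, u (j + i) < k * u (j + i + 1) ∧ k ^ i * u (j + 1) ≤ u (j + i + 1) := by
    intro i
    induction i with
    | zero => simpa using hj
    | succ i ih =>
      obtain ⟨h1, h2⟩ := ih
      have h3 : k * u (j + i + 1) ≤ u (j + i + 2) := by
        rcases le_max_iff.1 (hu (j + i)) with h | h
        · exact h
        · linarith
      have h5 : 0 < u (j + i + 1) := lt_of_lt_of_le (by positivity) h2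
      have e : j + (i + 1) = j + i + 1 := by ring
      rw [e]
      have h6 : u (j + i + 1) < u (j + i + 2) := by nlinarith
      refine ⟨show u (j + i + 1) < k * u (j + i + 2) by nlinarith, ?_⟩
      calc k ^ (i + 1) * u (j + 1) = k * (k ^ i * u (j + 1)) := by ring
        _ ≤ k * u (j + i + 1) := by gcongr
        _ ≤ _ := h3
  obtain ⟨n, hn⟩ := pow_unbounded_of_one_lt (δ / u (j + 1)) hk
  rw [div_lt_iff₀ hpos] at hn
  linarith [(key n).2, hδ (j + n + 1)]

theorem pow_mul_le_of_bounded {u : ℕ → ℝ} {k δ : ℝ} (hk : 1 < k) (h0 : ∀ j, 0 ≤ u j)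
    (hδ : ∀ j, u j ≤ δ) (hu : ∀ j, k * u (j + 1) ≤ max (u (j + 2)) (u j)) (n : ℕ) :
    k ^ n * u n ≤ u 0 := by
  induction n with
  | zero => simp
  | succ n ih =>
    calc k ^ (n + 1) * u (n + 1) = k ^ n * (k * u (n + 1)) := by ring
      _ ≤ k ^ n * u n := by
        gcongr
        exact mul_succ_le_of_bounded hk h0 hδ hu n
      _ ≤ _ := ih

theorem Homeomorph.pow_apply_eq_iterate {M : Type*} [TopologicalSpace M] (f : M ≃ₜ M) (n : ℕ)
    (x : M) : (f ^ n) x = f^[n] x := by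
  induction n generalizing x with
  | zero => rfl
  | succ n ih => rw [pow_succ, Homeomorph.mul_apply, ih, Function.iterate_succ_apply]

theorem Homeomorph.symm_iterate_iterate {M : Type*} [TopologicalSpace M] (f : M ≃ₜ M) {j n : ℕ}
    (h : j ≤ n) (x : M) : f.symm^[j] (f^[n] x) = f^[n - j] x := by
  obtain ⟨i, rfl⟩ := Nat.exists_eq_add_of_le h
  have hl : Function.LeftInverse f.symm f := f.symm_apply_apply
  rw [Function.iterate_add_apply, hl.iterate j, Nat.add_sub_cancel_left]

/-! ### Local stable sets and their contraction. -/

/-- The local stable set of `x` at scale `δ`. -/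
def localStableSet {M : Type*} [PseudoMetricSpace M] (f : M → M) (δ : ℝ) (x : M) : Set M :=
  {y | ∀ j : ℕ, dist (f^[j] x) (f^[j] y) ≤ δ}

/-- The homeomorphism `f` expands distances by the factor `k`, in the future or in the past, up to
the scale `ε`. -/
def IsHyperbolicDist {M : Type*} [PseudoMetricSpace M] (f : M ≃ₜ M) (k ε : ℝ) : Prop :=
  ∀ x y, min (k * dist x y) ε ≤ max (dist (f x) (f y)) (dist (f.symm x) (f.symm y))

namespace IsHyperbolicDist

variable {M : Type*} [MetricSpace M] {f : M ≃ₜ M} {k ε δ : ℝ}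

theorem symm (H : IsHyperbolicDist f k ε) : IsHyperbolicDist f.symm k ε := fun x y => by
  rw [max_comm]; exact H x y

theorem mul_dist_le_max (H : IsHyperbolicDist f k ε) (hδ : δ < ε) {x y : M}
    (h1 : dist (f x) (f y) ≤ δ) (h2 : dist (f.symm x) (f.symm y) ≤ δ) :
    k * dist x y ≤ max (dist (f x) (f y)) (dist (f.symm x) (f.symm y)) := by
  rcases min_le_iff.1 (H x y) with h | h
  · exact h
  · exact absurd (h.trans (max_le h1 h2)) (not_le.2 hδ)

theorem pow_mul_dist_iterate_le (H : IsHyperbolicDist f k ε) (hk : 1 < k) (hδ : δ < ε) {x y : M}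
    (hy : y ∈ localStableSet f δ x) (n : ℕ) :
    k ^ n * dist (f^[n] x) (f^[n] y) ≤ dist x y := by
  refine pow_mul_le_of_bounded (u := fun n => dist (f^[n] x) (f^[n] y)) hk
    (fun _ => dist_nonneg) hy (fun j => ?_) n
  have h1 := hy (j + 2)
  have h2 := hy j
  have := H.mul_dist_le_max (x := f^[j + 1] x) (y := f^[j + 1] y) hδ
  have e (z : M) : f (f^[j + 1] z) = f^[j + 2] z := (Function.iterate_succ_apply' f (j + 1) z).symm
  have e' (z : M) : f.symm (f^[j + 1] z) = f^[j] z := by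
    rw [Function.iterate_succ_apply', f.symm_apply_apply]
  simp only [e, e'] at this
  exact this h1 h2

/-- Both one-step images would be closer by the factor `k`, while hyperbolicity makes one of them
farther by that factor. -/
theorem eq_of_mem_localStableSet (H : IsHyperbolicDist f k ε) (hk : 1 < k) (hδ : δ < ε) {x y : M}
    (h1 : y ∈ localStableSet f δ x) (h2 : y ∈ localStableSet f.symm δ x) : y = x := by
  have a1 := H.pow_mul_dist_iterate_le hk hδ h1 1
  have a2 := H.symm.pow_mul_dist_iterate_le hk hδ h2 1
  have a3 := H.mul_dist_le_max hδ (h1 1) (h2 1)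
  simp only [pow_one, Function.iterate_one] at a1 a2
  have h0 : dist x y = 0 := by
    refine le_antisymm ?_ dist_nonneg
    have h4 : k * (k * dist x y) ≤ dist x y := by
      rcases le_max_iff.1 a3 with h | h
      · exact (mul_le_mul_of_nonneg_left h (by linarith)).trans a1
      · exact (mul_le_mul_of_nonneg_left h (by linarith)).trans a2
    by_contra! h5
    have h6 : dist x y < k * dist x y := by nlinarith
    nlinarith
  exact (dist_eq_zero.1 h0).symm

end IsHyperbolicDist

/-! ### Nontriviality of local stable sets. -/

/-- Every ball of radius `r` lies in a connected subset of the concentric ball of radius `δ`. -/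
def BallsConnectedIn (M : Type*) [PseudoMetricSpace M] (r δ : ℝ) : Prop :=
  ∀ p : M, ∃ C : Set M, IsPreconnected C ∧ Metric.ball p r ⊆ C ∧ C ⊆ Metric.ball p δ

/-- In a compact locally connected metric space, small balls lie in small connected sets,
uniformly. -/
theorem exists_ballsConnectedIn {M : Type*} [PseudoMetricSpace M] [CompactSpace M]
    [LocallyConnectedSpace M] {δ : ℝ} (hδ : 0 < δ) :
    ∃ r > 0, BallsConnectedIn M r δ := by
  have h : ∀ p : M, ∃ V : Set M, V ⊆ Metric.ball p (δ / 2) ∧ IsOpen V ∧ p ∈ V ∧ IsConnected V :=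
    fun p => locallyConnectedSpace_iff_subsets_isOpen_isConnected.1 inferInstance p _
      (Metric.ball_mem_nhds p (half_pos hδ))
  choose V hV1 hV2 hV3 hV4 using h
  obtain ⟨r, hr, h⟩ := lebesgue_number_lemma_of_metric (s := (Set.univ : Set M)) isCompact_univ hV2
    (fun p _ => Set.mem_iUnion.2 ⟨p, hV3 p⟩)
  refine ⟨r, hr, fun p => ?_⟩
  obtain ⟨q, hq⟩ := h p trivial
  refine ⟨V q, (hV4 q).isPreconnected, hq, fun z hz => ?_⟩
  have h1 := hV1 q hz
  have h2 := hV1 q (hq (Metric.mem_ball_self hr))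
  rw [Metric.mem_ball] at *
  linarith [dist_triangle_right z p q]

/-- The ball of radius `r` around `f^[n] x` follows the past orbit of that point up to time `-n`. -/
def FollowsPast {M : Type*} [PseudoMetricSpace M] (f : M ≃ₜ M) (r δ : ℝ) (x : M) (n : ℕ) : Prop :=
  ∀ z, dist z (f^[n] x) < r → ∀ j ≤ n, dist (f.symm^[j] z) (f^[n - j] x) ≤ δ

section stable

variable {M : Type*} [MetricSpace M] {f : M ≃ₜ M} {k ε δ r : ℝ}

theorem continuous_dist_iterate (f : M ≃ₜ M) (j : ℕ) (x : M) :
    Continuous fun y => dist (f^[j] x) (f^[j] y) :=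
  continuous_const.dist (f.continuous.iterate j)

/-- Finite orbit segments which start at distance at least `s` and stay `δ`-close give points of
the local stable set, by compactness. -/
theorem eventually_dist_lt_of_localStableSet [CompactSpace M] {s : ℝ} {x : M}
    (h : ∀ y ∈ localStableSet f δ x, dist x y < s) :
    ∃ N : ℕ, ∀ y, (∀ j ≤ N, dist (f^[j] x) (f^[j] y) ≤ δ) → dist x y < s := by
  by_contra! hN
  let D : ℕ → Set M := fun n => {y | (∀ j ≤ n, dist (f^[j] x) (f^[j] y) ≤ δ) ∧ s ≤ dist x y}
  have hcl : ∀ n, IsClosed (D n) := fun n => by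
    refine IsClosed.inter (s₁ := {y | ∀ j ≤ n, dist (f^[j] x) (f^[j] y) ≤ δ}) ?_
      (isClosed_le continuous_const (continuous_const.dist continuous_id))
    simp only [Set.ofPred_forall]
    exact isClosed_iInter fun j => isClosed_iInter fun _ =>
      isClosed_le (continuous_dist_iterate f j x) continuous_const
  obtain ⟨y, hy⟩ := IsCompact.nonempty_iInter_of_sequence_nonempty_isCompact_isClosed D
    (fun n y hy => ⟨fun j hj => hy.1 j (by omega), hy.2⟩) (fun n => hN n) (hcl 0).isCompact hcl
  rw [Set.mem_iInter] at hy
  exact absurd (h y fun j => (hy j).1 j le_rfl) (not_lt.2 (hy 0).2)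

/-- A connectedness argument: the points following the past strictly within `δ` form an open set,
and no point of the connected set `C` can lie on its boundary. There some past distance would equal
`δ`, which is excluded at both end times and, by a maximum principle, in between. -/
theorem IsHyperbolicDist.exists_followsPast [CompactSpace M] (H : IsHyperbolicDist f k ε)
    (hk : 1 < k) (h0 : 0 < δ) (hδ : δ < ε) (hr : 0 < r) (hC : BallsConnectedIn M r δ) {x : M}
    (h : ∀ y ∈ localStableSet f δ x, dist x y < δ) :
    ∃ N : ℕ, ∀ n ≥ N, FollowsPast f r δ x n := by
  obtain ⟨N, hN⟩ := eventually_dist_lt_of_localStableSet h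
  refine ⟨N, fun n hn z hz => ?_⟩
  obtain ⟨C, hC1, hC2, hC3⟩ := hC (f^[n] x)
  let φ : ℕ → M → ℝ := fun j w => dist (f.symm^[j] w) (f^[n - j] x)
  have hφ : ∀ j, Continuous (φ j) := fun j =>
    (f.symm.continuous.iterate j).dist continuous_const
  let U : Set M := {w | ∀ j ≤ n, φ j w < δ}
  have hU : IsOpen U := by
    have : U = ⋂ j ∈ Set.Iic n, {w | φ j w < δ} := by ext; simp [U]
    rw [this]
    exact (Set.finite_Iic n).isOpen_biInter fun j _ => isOpen_lt (hφ j) continuous_const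
  have hUcl : closure U ⊆ {w | ∀ j ≤ n, φ j w ≤ δ} := by
    refine closure_minimal (fun w hw j hj => (hw j hj).le) ?_
    simp only [Set.ofPred_forall]
    exact isClosed_iInter fun j => isClosed_iInter fun _ => isClosed_le (hφ j) continuous_const
  have hsub : C ⊆ U := by
    refine hC1.subset_of_closure_inter_subset hU ⟨f^[n] x, hC2 (Metric.mem_ball_self hr), ?_⟩ ?_
    · intro j hj
      simp only [φ, f.symm_iterate_iterate hj, dist_self, h0]
    · rintro w ⟨hw, hwC⟩ j hj
      have hw : ∀ j ≤ n, φ j w ≤ δ := hUcl hw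
      refine lt_of_le_of_ne (hw j hj) fun hjδ => ?_
      rcases Nat.eq_zero_or_pos j with rfl | hj0
      · have := hC3 hwC
        rw [Metric.mem_ball] at this
        simp only [φ, Function.iterate_zero, id, Nat.sub_zero] at hjδ
        linarith
      -- At `j = n` the pulled-back point shadows the orbit of `x` for at least `N` steps, so
      -- compactness keeps it strictly inside the `δ`-sphere.
      rcases hj.eq_or_lt with rfl | hjn
      · have hlt := hN (f.symm^[j] w) fun i hi => by
          have h1 := hw (j - i) (by omega)
          have h2 := f.symm.symm_iterate_iterate (show i ≤ j by omega) w
          rw [Homeomorph.symm_symm] at h2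
          rw [h2, dist_comm]
          simpa only [φ, show j - (j - i) = i by omega] using h1
        simp only [φ, Nat.sub_self, Function.iterate_zero, id] at hjδ
        rw [dist_comm] at hlt
        linarith
      -- Maximum principle: an interior distance equal to `δ` would force a neighbouring one to be
      -- at least `k * δ > δ`.
      · obtain ⟨i, rfl⟩ : ∃ i, j = i + 1 := ⟨j - 1, by omega⟩
        have h1 := hw i (by omega)
        have h2 := hw (i + 2) (by omega)
        have e1 : f (f.symm^[i + 1] w) = f.symm^[i] w := by
          rw [Function.iterate_succ_apply', f.apply_symm_apply]
        have e2 : f.symm (f.symm^[i + 1] w) = f.symm^[i + 2] w := by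
          rw [Function.iterate_succ_apply' _ (i + 1)]
        have e3 : f (f^[n - (i + 1)] x) = f^[n - i] x := by
          rw [← Function.iterate_succ_apply' f]; congr 2; omega
        have e4 : f.symm (f^[n - (i + 1)] x) = f^[n - (i + 2)] x := by
          rw [show n - (i + 1) = n - (i + 2) + 1 by omega, Function.iterate_succ_apply',
            f.symm_apply_apply]
        have := H.mul_dist_le_max (x := f.symm^[i + 1] w) (y := f^[n - (i + 1)] x) hδ
        rw [e1, e2, e3, e4] at this
        have h3 := (this h1 h2).trans (max_le h1 h2)
        have h4 : dist (f.symm^[i + 1] w) (f^[n - (i + 1)] x) = δ := hjδ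
        rw [h4] at h3
        nlinarith
  exact fun j hj => (hsub (hC2 (Metric.mem_ball.2 hz)) j hj).le

/-- If the local stable set at some scale is trivial, the local stable set at a larger scale does
not reach the sphere. -/
theorem IsHyperbolicDist.dist_lt_of_localStableSet_trivial [CompactSpace M]
    [LocallyConnectedSpace M] (H : IsHyperbolicDist f k ε) (hk : 1 < k) {δ' : ℝ} (h0 : 0 < δ') (hδ' : δ' < δ) (hδ : δ < ε)
    {x : M} (h : localStableSet f δ' x ⊆ {x}) : ∀ y ∈ localStableSet f δ x, dist x y < δ := by
  intro y hy
  obtain ⟨r, hr, hC⟩ := exists_ballsConnectedIn (M := M) h0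
  obtain ⟨N, hN⟩ := H.exists_followsPast hk h0 (hδ'.trans hδ) hr hC (x := x)
    (fun y hy => by rw [show y = x from h hy, dist_self]; exact h0)
  have hlim := tendsto_pow_atTop_atTop_of_one_lt hk
  obtain ⟨n, hn1, hn2⟩ := ((hlim.eventually_gt_atTop (dist x y / r)).and
    (eventually_ge_atTop N)).exists
  rw [div_lt_iff₀ hr] at hn1
  have h1 := H.pow_mul_dist_iterate_le hk hδ hy n
  have hkn : 0 < k ^ n := by positivity
  -- Contraction has brought `f^[n] y` into the `r`-ball of `f^[n] x`; following the past for all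
  -- `n` steps puts `y` within `δ'` of `x`.
  have h2 := hN n hn2 (f^[n] y) (by rw [dist_comm]; nlinarith) n le_rfl
  rw [f.symm_iterate_iterate le_rfl, Nat.sub_self, Function.iterate_zero, id, id, dist_comm] at h2
  linarith

/-- The `ω`-limit set of a point. -/
def omegaSet (f : M → M) (x : M) : Set M :=
  {p | ∀ η > 0, ∀ N : ℕ, ∃ n ≥ N, dist (f^[n] x) p < η}

theorem symm_iterate_mem_omegaSet {x p : M} (hp : p ∈ omegaSet f x) (j : ℕ) :
    f.symm^[j] p ∈ omegaSet f x := by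
  intro η hη N
  obtain ⟨ρ, hρ, h⟩ := Metric.continuous_iff.1 (f.symm.continuous.iterate j) p η hη
  obtain ⟨n, hn, hd⟩ := hp ρ hρ (N + j)
  have := h _ hd
  rw [f.symm_iterate_iterate (by omega)] at this
  exact ⟨n - j, by omega, this⟩

theorem omegaSet_nonempty [CompactSpace M] (f : M → M) (x : M) : (omegaSet f x).Nonempty := by
  obtain ⟨p, φ, hφ, hp⟩ := CompactSpace.tendsto_subseq fun n => f^[n] x
  refine ⟨p, fun η hη N => ?_⟩
  obtain ⟨n, h1, h2⟩ := ((Metric.tendsto_nhds.1 hp η hη).and (eventually_ge_atTop N)).exists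
  exact ⟨φ n, h2.trans hφ.le_apply, h1⟩

/-- Points of the `ω`-limit set inherit the property of following the past. -/
theorem ball_subset_of_mem_omegaSet {x p : M} {N : ℕ} (hN : ∀ n ≥ N, FollowsPast f r δ x n)
    (hp : p ∈ omegaSet f x) {z : M} (hz : dist z p < r) : z ∈ localStableSet f.symm δ p := by
  intro j
  refine le_of_forall_pos_le_add fun η hη => ?_
  obtain ⟨ρ, hρ, h⟩ := Metric.continuous_iff.1 (f.symm.continuous.iterate j) p η hη
  obtain ⟨n, hn, hd⟩ := hp (min ρ (r - dist z p)) (lt_min hρ (by linarith)) (max N j)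
  have h1 := h _ (hd.trans_le (min_le_left _ _))
  have h2 := hd.trans_le (min_le_right _ _)
  rw [f.symm_iterate_iterate (le_of_max_le_right hn)] at h1
  have h3 := hN n (le_of_max_le_left hn) z
    (by linarith [dist_triangle_right z (f^[n] x) p]) j (le_of_max_le_right hn)
  linarith [dist_triangle_left (f.symm^[j] p) (f.symm^[j] z) (f^[n - j] x),
    dist_comm (f.symm^[j] z) (f^[n - j] x)]

/-- Local stable sets of a hyperbolic homeomorphism are nontrivial at every point. -/
theorem IsHyperbolicDist.exists_mem_localStableSet_ne [CompactSpace M] [ConnectedSpace M]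
    [LocallyConnectedSpace M] [Nontrivial M] (H : IsHyperbolicDist f k ε) (hk : 1 < k)
    (hε : 0 < ε) {δ₀ : ℝ} (hδ₀ : 0 < δ₀)
    (x₀ : M) : ∃ y ∈ localStableSet f δ₀ x₀, y ≠ x₀ := by
  by_contra! hx₀
  -- Uniqueness is later applied at scale `2 * δ`, to two points whose past orbits are each
  -- `δ`-close to that of a third.
  obtain ⟨δ, hδ, hδ1, hδ2⟩ : ∃ δ, 0 < δ ∧ δ ≤ δ₀ ∧ 2 * δ < ε :=
    ⟨min δ₀ (ε / 3), by positivity, min_le_left _ _, by linarith [min_le_right δ₀ (ε / 3)]⟩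
  have hδε : δ < ε := by linarith
  obtain ⟨r, hr, hC⟩ := exists_ballsConnectedIn (M := M) hδ
  let P : Set M := {x | ∀ y ∈ localStableSet f δ x, dist x y < δ}
  have hstab : ∀ x ∈ P, ∀ p ∈ omegaSet f x, ∀ z, dist z p < r →
      z ∈ localStableSet f.symm δ p := fun x hx p hp z hz => by
    obtain ⟨N, hN⟩ := H.exists_followsPast hk hδ hδε hr hC hx
    exact ball_subset_of_mem_omegaSet hN hp hz
  -- For `q` in the `ω`-limit set, some late `f^[n] x` lies in the local unstable set of `q`.
  -- Pulling back `n` steps puts `x` close to `f.symm^[n] q`, which is again an `ω`-limit point.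
  have hrec : ∀ x ∈ P, x ∈ omegaSet f x := by
    intro x hx η hη N
    obtain ⟨q, hq⟩ := omegaSet_nonempty f x
    obtain ⟨n₀, hn₀⟩ := pow_unbounded_of_one_lt (r / (η / 2)) hk
    obtain ⟨n, hn, hd⟩ := hq r hr n₀
    have h1 := hstab x hx q hq _ hd
    have h2 := H.symm.pow_mul_dist_iterate_le hk hδε h1 n
    rw [f.symm_iterate_iterate le_rfl, Nat.sub_self, Function.iterate_zero, id] at h2
    have h3 : dist (f.symm^[n] q) x < η / 2 := by
      rw [div_lt_iff₀ (by positivity)] at hn₀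
      have : k ^ n₀ ≤ k ^ n := pow_le_pow_right₀ hk.le hn
      have h5 : 0 < k ^ n := by positivity
      rw [dist_comm] at hd
      by_contra! h6
      nlinarith
    obtain ⟨m, hm, hmd⟩ := symm_iterate_mem_omegaSet hq n (η / 2) (half_pos hη) N
    exact ⟨m, hm, by linarith [dist_triangle (f^[m] x) (f.symm^[n] q) x]⟩
  -- By recurrence the `r`-ball of `x` lies in its local unstable set. A stable companion of `z`
  -- close to it is then also an unstable companion, hence equals `z`. The radius does not depend on
  -- `x`, so `P` is closed as well as open.
  have hopen : ∀ x ∈ P, ∀ z, dist z x < r / 2 → z ∈ P := by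
    intro x hx z hz
    refine H.dist_lt_of_localStableSet_trivial hk (δ' := min (r / 2) (δ / 2)) (by positivity)
      ((min_le_right _ _).trans_lt (half_lt_self hδ)) hδε fun y hy => ?_
    have hyz : dist z y ≤ r / 2 := (hy 0).trans (min_le_left _ _)
    have hs := hstab x hx x (hrec x hx)
    have h1 := hs z (by linarith)
    have h2 := hs y (by linarith [dist_triangle_left y x z])
    refine H.eq_of_mem_localStableSet hk hδ2 (fun j => ?_) (fun j => ?_)
    · linarith [hy j, min_le_right (r / 2) (δ / 2)]
    · linarith [h1 j, h2 j, dist_triangle_left (f.symm^[j] z) (f.symm^[j] y) (f.symm^[j] x)]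
  have hPuniv : P = Set.univ := by
    refine IsClopen.eq_univ ⟨?_, ?_⟩ ⟨x₀, fun y hy => ?_⟩
    · refine isClosed_of_closure_subset fun z hz => ?_
      obtain ⟨x, hx, hd⟩ := Metric.mem_closure_iff.1 hz (r / 2) (half_pos hr)
      exact hopen x hx z hd
    · exact Metric.isOpen_iff.2 fun x hx => ⟨r / 2, half_pos hr, fun z hz => hopen x hx z hz⟩
    · rw [hx₀ y fun j => (hy j).trans hδ1, dist_self]
      exact hδ
  -- Every `r`-ball is now contracted by past iterates; two points within `r` at a late time `n`
  -- would have started closer than `dist x y`.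
  have hcontr : ∀ x y : M, x ≠ y → ∀ᶠ n in atTop, r ≤ dist (f^[n] x) (f^[n] y) := by
    intro x y hxy
    have hpos := dist_pos.2 hxy
    filter_upwards [(tendsto_pow_atTop_atTop_of_one_lt hk).eventually_gt_atTop (r / dist x y)]
      with n hn
    by_contra! hlt
    have hmem : f^[n] y ∈ P := by rw [hPuniv]; trivial
    have h1 := hstab _ hmem _ (hrec _ hmem) _ hlt
    have h2 := H.symm.pow_mul_dist_iterate_le hk hδε h1 n
    rw [f.symm_iterate_iterate le_rfl, f.symm_iterate_iterate le_rfl, Nat.sub_self,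
      Function.iterate_zero, id, id, dist_comm] at h2
    rw [div_lt_iff₀ hpos] at hn
    rw [dist_comm] at hlt
    linarith
  -- Pigeonhole: one more point than an `r / 2`-net has centres, all pairwise `r`-separated at a
  -- common time.
  obtain ⟨t, htf, ht⟩ := Metric.totallyBounded_iff.1
    (isCompact_univ (X := M)).totallyBounded (r / 2) (half_pos hr)
  have hinf : (Set.univ : Set M).Infinite := isPreconnected_univ.infinite_of_nontrivial
    Set.nontrivial_univ
  have : Infinite M := Set.infinite_univ_iff.1 hinf
  obtain ⟨S, hS⟩ := Infinite.exists_subset_card_eq M (htf.toFinset.card + 1)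
  have hev : ∀ᶠ n in atTop, ∀ p ∈ S.offDiag, r ≤ dist (f^[n] p.1) (f^[n] p.2) :=
    (eventually_all_finset _).2 fun p hp => hcontr _ _ (Finset.mem_offDiag.1 hp).2.2
  obtain ⟨n, hn⟩ := hev.exists
  have hcov : ∀ x : M, ∃ c ∈ t, dist (f^[n] x) c < r / 2 := fun x => by
    simpa using ht (Set.mem_univ (f^[n] x))
  choose c hct hc using hcov
  obtain ⟨x, hx, y, hy, hxy, he⟩ := Finset.exists_ne_map_eq_of_card_lt_of_maps_to
    (s := S) (t := htf.toFinset) (f := c) (by omega) (fun x _ => by simpa using hct x)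
  have h1 := hn (x, y) (Finset.mem_offDiag.2 ⟨hx, hy, hxy⟩)
  have h2 := hc x
  have h3 := hc y
  rw [← he] at h3
  have h4 := dist_triangle_right (f^[n] x) (f^[n] y) (c x)
  simp only at h1
  linarith

end stable

/-! ### Bounds on the exponents and existence of the limits. -/

theorem ENNReal.coe_log_le_log_div {c : ℝ} (hc : 0 < c) {n : ℕ} (hn : 0 < n) {A : ℝ≥0∞}
    (h : ENNReal.ofReal (c ^ n) ≤ A) : (Real.log c : EReal) ≤ ENNReal.log A / (n : EReal) := by
  rw [EReal.le_div_iff_mul_le (by exact_mod_cast hn) (EReal.natCast_ne_top n)]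
  refine le_trans (le_of_eq ?_) (ENNReal.log_le_log h)
  rw [ENNReal.log_ofReal_of_pos (pow_pos hc n), Real.log_pow, EReal.coe_mul, mul_comm,
    EReal.coe_natCast]

theorem ENNReal.log_div_le_coe_log {c : ℝ} (hc : 0 < c) {n : ℕ} (hn : 0 < n) {A : ℝ≥0∞}
    (h : A ≤ ENNReal.ofReal (c ^ n)) : ENNReal.log A / (n : EReal) ≤ (Real.log c : EReal) := by
  rw [EReal.div_le_iff_le_mul (by exact_mod_cast hn) (EReal.natCast_ne_top n)]
  refine (ENNReal.log_le_log h).trans (le_of_eq ?_)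
  rw [ENNReal.log_ofReal_of_pos (pow_pos hc n), Real.log_pow, EReal.coe_mul, EReal.coe_natCast]

theorem dist_iterate_le_pow_mul {M : Type*} [PseudoMetricSpace M] {f : M → M} {K : ℝ} (hK : 0 ≤ K)
    (h : ∀ x y, dist (f x) (f y) ≤ K * dist x y) (n : ℕ) (x y : M) :
    dist (f^[n] x) (f^[n] y) ≤ K ^ n * dist x y := by
  induction n generalizing x y with
  | zero => simp
  | succ n ih =>
    rw [Function.iterate_succ_apply, Function.iterate_succ_apply]
    calc _ ≤ K ^ n * dist (f x) (f y) := ih _ _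
      _ ≤ K ^ n * (K * dist x y) := by gcongr; exact h x y
      _ = _ := by ring

namespace LyapunovExponent

section monotonicity

variable {M : Type*} [TopologicalSpace M] (f : M ≃ₜ M) (d : M → M → ℝ)

theorem puncturedBall_mono (x : M) (n : ℕ) : Monotone fun δ => puncturedBall f d δ x n :=
  fun _ _ h _ hy => ⟨hy.1, fun j hj => (hy.2 j hj).trans h⟩

theorem maxExponentAtScale_mono (x : M) : Monotone fun δ => maxExponentAtScale f d δ x :=
  fun _ _ h => limsup_le_limsup (Eventually.of_forall fun n =>
    EReal.div_le_div_right_of_nonneg (by positivity) (ENNReal.log_le_log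
      (biSup_mono fun _ hy => puncturedBall_mono f d x n h hy)))

theorem minExponentAtScale_anti (x : M) : Antitone fun δ => minExponentAtScale f d δ x :=
  fun _ _ h => limsup_le_limsup (Eventually.of_forall fun n =>
    EReal.div_le_div_right_of_nonneg (by positivity) (ENNReal.log_le_log
      (biInf_mono fun _ hy => puncturedBall_mono f d x n h hy)))

end monotonicity

variable {M : Type*} [MetricSpace M] {f : M ≃ₜ M} {K δ : ℝ}

theorem maxExponentAtScale_le (hK : 0 < K) (h : ∀ x y, dist (f x) (f y) ≤ K * dist x y) (x : M) :
    maxExponentAtScale f dist δ x ≤ Real.log K := by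
  refine limsup_le_of_le (by isBoundedDefault) ?_
  filter_upwards [eventually_gt_atTop 0] with n hn
  refine ENNReal.log_div_le_coe_log hK hn (iSup₂_le fun y hy => ENNReal.ofReal_le_ofReal ?_)
  rw [div_le_iff₀ (dist_pos.2 hy.1.symm), f.pow_apply_eq_iterate, f.pow_apply_eq_iterate]
  exact dist_iterate_le_pow_mul hK.le h n x y

theorem le_minExponentAtScale (hK : 0 < K)
    (h : ∀ x y, dist (f.symm x) (f.symm y) ≤ K * dist x y) (x : M) :
    ((-Real.log K : ℝ) : EReal) ≤ minExponentAtScale f dist δ x := by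
  refine le_limsup_of_frequently_le (Eventually.frequently ?_) (by isBoundedDefault)
  filter_upwards [eventually_gt_atTop 0] with n hn
  rw [← Real.log_inv]
  refine ENNReal.coe_log_le_log_div (inv_pos.2 hK) hn
    (le_iInf₂ fun y hy => ENNReal.ofReal_le_ofReal ?_)
  rw [le_div_iff₀ (dist_pos.2 hy.1.symm), f.pow_apply_eq_iterate, f.pow_apply_eq_iterate, inv_pow,
    inv_mul_le_iff₀ (by positivity)]
  have := dist_iterate_le_pow_mul hK.le h n (f^[n] x) (f^[n] y)
  simpa only [f.symm_iterate_iterate le_rfl, Nat.sub_self, Function.iterate_zero, id] using this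

variable [CompactSpace M] [ConnectedSpace M] [LocallyConnectedSpace M] [Nontrivial M] {k ε : ℝ}

theorem log_le_maxExponentAtScale (H : IsHyperbolicDist f k ε) (hk : 1 < k) (hε : 0 < ε)
    (hδ : 0 < δ) (x : M) : (Real.log k : EReal) ≤ maxExponentAtScale f dist δ x := by
  -- Contraction needs a scale below the threshold; monotonicity in the scale allows shrinking to
  -- one.
  refine le_trans ?_ (maxExponentAtScale_mono f dist x (min_le_left δ (ε / 2)))
  have hδ' : 0 < min δ (ε / 2) := by positivity
  have hδε : min δ (ε / 2) < ε := (min_le_right _ _).trans_lt (half_lt_self hε)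
  generalize min δ (ε / 2) = δ at hδ' hδε
  refine le_limsup_of_frequently_le (Eventually.frequently ?_) (by isBoundedDefault)
  filter_upwards [eventually_gt_atTop 0] with n hn
  refine ENNReal.coe_log_le_log_div (by positivity) hn ?_
  -- The unstable point is taken at `f^[n] x`, so its pullback stays `δ`-close to `x` up to time `n`
  -- and is separated by the factor `kⁿ`.
  obtain ⟨z, hz, hne⟩ := H.symm.exists_mem_localStableSet_ne hk hε hδ' (f^[n] x)
  have hfz (j : ℕ) (hj : j ≤ n) : f^[j] (f.symm^[n] z) = f.symm^[n - j] z := by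
    simpa using f.symm.symm_iterate_iterate hj z
  have hfz' : f^[n] (f.symm^[n] z) = z := by simpa using hfz n le_rfl
  have hyx : f.symm^[n] z ≠ x := fun h => hne (by rw [← hfz', h])
  refine le_iSup₂_of_le (f.symm^[n] z) ⟨hyx, fun j hj => ?_⟩ (ENNReal.ofReal_le_ofReal ?_)
  · have h1 := hz (n - j)
    rw [f.symm_iterate_iterate (by omega), show n - (n - j) = j by omega] at h1
    rw [f.pow_apply_eq_iterate, f.pow_apply_eq_iterate, hfz j hj]
    exact h1
  · have h1 := H.symm.pow_mul_dist_iterate_le hk hδε hz n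
    rw [f.symm_iterate_iterate le_rfl, Nat.sub_self, Function.iterate_zero, id] at h1
    rw [le_div_iff₀ (dist_pos.2 hyx.symm), f.pow_apply_eq_iterate, f.pow_apply_eq_iterate, hfz']
    exact h1

theorem minExponentAtScale_le_neg_log (H : IsHyperbolicDist f k ε) (hk : 1 < k) (hε : 0 < ε)
    (hδ : 0 < δ) (x : M) : minExponentAtScale f dist δ x ≤ ((-Real.log k : ℝ) : EReal) := by
  refine (minExponentAtScale_anti f dist x (min_le_left δ (ε / 2))).trans ?_
  have hδ' : 0 < min δ (ε / 2) := by positivity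
  have hδε : min δ (ε / 2) < ε := (min_le_right _ _).trans_lt (half_lt_self hε)
  generalize min δ (ε / 2) = δ at hδ' hδε
  refine limsup_le_of_le (by isBoundedDefault) ?_
  filter_upwards [eventually_gt_atTop 0] with n hn
  rw [← Real.log_inv]
  refine ENNReal.log_div_le_coe_log (by positivity) hn ?_
  obtain ⟨y, hy, hne⟩ := H.exists_mem_localStableSet_ne hk hε hδ' x
  refine iInf₂_le_of_le y ⟨hne, fun j _ => ?_⟩ (ENNReal.ofReal_le_ofReal ?_)
  · rw [f.pow_apply_eq_iterate, f.pow_apply_eq_iterate]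
    exact hy j
  · rw [div_le_iff₀ (dist_pos.2 hne.symm), f.pow_apply_eq_iterate, f.pow_apply_eq_iterate, inv_pow,
      le_inv_mul_iff₀ (by positivity)]
    exact H.pow_mul_dist_iterate_le hk hδε hy n

end LyapunovExponent

theorem EReal.exists_tendsto_coe {ι : Type*} {l : Filter ι} [l.NeBot] {u : ι → EReal} {L : EReal}
    {a b : ℝ} (hu : Tendsto u l (𝓝 L)) (ha : ∀ᶠ i in l, (a : EReal) ≤ u i)
    (hb : ∀ᶠ i in l, u i ≤ (b : EReal)) :
    ∃ c : ℝ, Tendsto u l (𝓝 (c : EReal)) ∧ a ≤ c ∧ c ≤ b := by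
  have h1 := ge_of_tendsto hu ha
  have h2 := le_of_tendsto hu hb
  lift L to ℝ using ⟨(h2.trans_lt (EReal.coe_lt_top b)).ne, ((EReal.bot_lt_coe a).trans_le h1).ne'⟩
  exact ⟨L, hu, by exact_mod_cast h1, by exact_mod_cast h2⟩

theorem IsHyperbolicDist.exists_exponents {M : Type*} [MetricSpace M] [CompactSpace M]
    [ConnectedSpace M] [LocallyConnectedSpace M] [Nontrivial M] {f : M ≃ₜ M} {k ε : ℝ}
    (H : IsHyperbolicDist f k ε) (hk : 1 < k) (hε : 0 < ε)
    (h1 : ∃ K : ℝ, ∀ x y, dist (f x) (f y) ≤ K * dist x y)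
    (h2 : ∃ K : ℝ, ∀ x y, dist (f.symm x) (f.symm y) ≤ K * dist x y) (x : M) :
    ∃ L l : ℝ, LyapunovExponent.HasMaxExponent f dist x L ∧
      LyapunovExponent.HasMinExponent f dist x l ∧ Real.log k ≤ L ∧ l ≤ -Real.log k := by
  have hpos {h : M → M} : (∃ K : ℝ, ∀ x y, dist (h x) (h y) ≤ K * dist x y) →
      ∃ K : ℝ, 0 < K ∧ ∀ x y, dist (h x) (h y) ≤ K * dist x y := fun ⟨K, hK⟩ =>
    ⟨max K 1, by positivity, fun x y => (hK x y).trans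
      (mul_le_mul_of_nonneg_right (le_max_left _ _) dist_nonneg)⟩
  obtain ⟨K₁, hK₁, h1⟩ := hpos h1
  obtain ⟨K₂, hK₂, h2⟩ := hpos h2
  obtain ⟨L, hL, hL', -⟩ := EReal.exists_tendsto_coe
    ((LyapunovExponent.maxExponentAtScale_mono f dist x).tendsto_nhdsGT 0)
    (eventually_mem_nhdsWithin.mono fun δ hδ =>
      LyapunovExponent.log_le_maxExponentAtScale H hk hε hδ x)
    (Eventually.of_forall fun δ => LyapunovExponent.maxExponentAtScale_le hK₁ h1 x)
  obtain ⟨l, hl, -, hl'⟩ := EReal.exists_tendsto_coe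
    ((LyapunovExponent.minExponentAtScale_anti f dist x).tendsto_nhdsGT 0)
    (Eventually.of_forall fun δ => LyapunovExponent.le_minExponentAtScale hK₂ h2 x)
    (eventually_mem_nhdsWithin.mono fun δ hδ =>
      LyapunovExponent.minExponentAtScale_le_neg_log H hk hε hδ x)
  exact ⟨L, l, hL, hl, hL', hl'⟩

/-- The metric space structure given by a metric compatible with the topology. -/
noncomputable abbrev IsCompatibleMetric.toMetricSpace {M : Type*} [TopologicalSpace M]
    {d : M → M → ℝ} (hd : IsCompatibleMetric d) : MetricSpace M :=
  MetricSpace.ofDistTopology d (fun x => (hd.eq_zero_iff x x).2 rfl) hd.symm hd.triangle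
    hd.isOpen_iff (fun x y => (hd.eq_zero_iff x y).1)

theorem IsHyperbolicMetric.exists_exponents {M : Type*} [TopologicalSpace M] [CompactSpace M]
    [ConnectedSpace M] [LocallyConnectedSpace M] [Nontrivial M] {f : M ≃ₜ M} {d : M → M → ℝ}
    {k ε₀ : ℝ} (H : IsHyperbolicMetric f d k ε₀) (x : M) :
    ∃ L l : ℝ, LyapunovExponent.HasMaxExponent f d x L ∧
      LyapunovExponent.HasMinExponent f d x l ∧ Real.log k ≤ L ∧ l ≤ -Real.log k := by
  let := H.isCompatibleMetric.toMetricSpace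
  exact IsHyperbolicDist.exists_exponents (f := f) (k := k) (ε := ε₀) H.hyperbolic H.one_lt H.pos
    H.lipschitz H.lipschitz_symm x

/-! ### From an expanding power to an adapted metric. -/

/-- A metric which is equivalent to the ambient one defines the same topology. -/
theorem IsCompatibleMetric.of_equivalent {M : Type*} [MetricSpace M] {d : M → M → ℝ} {C : ℝ}
    (h1 : ∀ x y, dist x y ≤ d x y) (h2 : ∀ x y, d x y ≤ C * dist x y)
    (hsymm : ∀ x y, d x y = d y x) (htri : ∀ x y z, d x z ≤ d x y + d y z) :
    IsCompatibleMetric d where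
  eq_zero_iff x y := by
    refine ⟨fun h => dist_le_zero.1 ((h1 x y).trans h.le), ?_⟩
    rintro rfl
    refine le_antisymm ((h2 x x).trans_eq (by simp)) (dist_nonneg.trans (h1 x x))
  symm := hsymm
  triangle := htri
  isOpen_iff s := by
    rw [Metric.isOpen_iff]
    refine forall₂_congr fun x _ => ⟨?_, ?_⟩
    · rintro ⟨r, hr, h⟩
      exact ⟨r, hr, fun y hy => h (by rw [Metric.mem_ball']; exact (h1 x y).trans_lt hy)⟩
    · rintro ⟨r, hr, h⟩
      refine ⟨r / max C 1, by positivity, fun y hy => h y ?_⟩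
      rw [Metric.mem_ball', lt_div_iff₀' (by positivity)] at hy
      exact ((h2 x y).trans (mul_le_mul_of_nonneg_right (le_max_left C 1) dist_nonneg)).trans_lt hy

/-- For every `N ≠ 0`, every `c ∈ (0, 1)` has an `N`-th root in `(0, 1)`. -/
theorem exists_pow_eq_of_lt_one {c : ℝ} (h0 : 0 < c) (h1 : c < 1) {N : ℕ} (hN : N ≠ 0) :
    ∃ b : ℝ, 0 < b ∧ b < 1 ∧ b ^ N = c :=
  ⟨c ^ (N⁻¹ : ℝ), Real.rpow_pos_of_pos h0 _, Real.rpow_lt_one h0.le h1 (by positivity),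
    Real.rpow_inv_natCast_pow h0.le hN⟩

/-- The metric `max_{|i| ≤ p} μ ^ |i| * dist (f ^ i x) (f ^ i y)`. -/
noncomputable def averagedDist {M : Type*} [PseudoMetricSpace M] (f : M ≃ₜ M) (μ : ℝ) (p : ℕ)
    (x y : M) : ℝ :=
  (Finset.range (p + 1)).sup' Finset.nonempty_range_add_one fun i =>
    μ ^ i * max (dist (f^[i] x) (f^[i] y)) (dist (f.symm^[i] x) (f.symm^[i] y))

section averaged

variable {M : Type*} [MetricSpace M] {f : M ≃ₜ M} {μ K : ℝ} {p : ℕ}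

theorem le_averagedDist (f : M ≃ₜ M) (μ : ℝ) {i : ℕ} (hi : i ≤ p) (x y : M) :
    μ ^ i * max (dist (f^[i] x) (f^[i] y)) (dist (f.symm^[i] x) (f.symm^[i] y)) ≤
      averagedDist f μ p x y :=
  Finset.le_sup' (fun i => μ ^ i * max (dist (f^[i] x) (f^[i] y))
    (dist (f.symm^[i] x) (f.symm^[i] y))) (Finset.mem_range_succ_iff.2 hi)

theorem averagedDist_le {x y : M} {a : ℝ} (h : ∀ i ≤ p,
      μ ^ i * max (dist (f^[i] x) (f^[i] y)) (dist (f.symm^[i] x) (f.symm^[i] y)) ≤ a) :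
    averagedDist f μ p x y ≤ a :=
  Finset.sup'_le _ _ fun i hi => h i (Finset.mem_range_succ_iff.1 hi)

theorem dist_le_averagedDist (x y : M) : dist x y ≤ averagedDist f μ p x y := by
  simpa using le_averagedDist f μ (Nat.zero_le p) x y

theorem averagedDist_symm_homeo (f : M ≃ₜ M) (x y : M) :
    averagedDist f.symm μ p x y = averagedDist f μ p x y := by
  simp only [averagedDist, Homeomorph.symm_symm]
  congr 1
  ext i
  rw [max_comm]

theorem averagedDist_map_le (hμ : 0 < μ) (hK : 0 ≤ K) {h : M → M} (hf : Function.Commute h f)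
    (hg : Function.Commute h f.symm) (hh : ∀ x y, dist (h x) (h y) ≤ K * dist x y) (x y : M) :
    averagedDist f μ p (h x) (h y) ≤ K * averagedDist f μ p x y := by
  refine averagedDist_le fun i hi => ?_
  rw [← (hf.iterate_right i).eq, ← (hf.iterate_right i).eq, ← (hg.iterate_right i).eq,
    ← (hg.iterate_right i).eq]
  calc _ ≤ μ ^ i * max (K * dist (f^[i] x) (f^[i] y)) (K * dist (f.symm^[i] x) (f.symm^[i] y)) := by
        gcongr <;> exact hh _ _
    _ = K * (μ ^ i * max (dist (f^[i] x) (f^[i] y)) (dist (f.symm^[i] x) (f.symm^[i] y))) := by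
        rw [← mul_max_of_nonneg _ _ hK]; ring
    _ ≤ _ := by gcongr; exact le_averagedDist f μ hi x y

theorem isCompatibleMetric_averagedDist (hμ : 0 < μ) (hK : 0 ≤ K)
    (h1 : ∀ x y, dist (f x) (f y) ≤ K * dist x y)
    (h2 : ∀ x y, dist (f.symm x) (f.symm y) ≤ K * dist x y) :
    IsCompatibleMetric (averagedDist f μ p) := by
  refine IsCompatibleMetric.of_equivalent (C := (max (μ * K) 1) ^ p) dist_le_averagedDist
    (fun x y => averagedDist_le fun i hi => ?_) (fun x y => ?_)
    (fun x y z => averagedDist_le fun i hi => ?_)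
  · calc _ ≤ μ ^ i * max (K ^ i * dist x y) (K ^ i * dist x y) := by
          gcongr
          exacts [dist_iterate_le_pow_mul hK h1 i x y, dist_iterate_le_pow_mul hK h2 i x y]
      _ = (μ * K) ^ i * dist x y := by rw [max_self]; ring
      _ ≤ (max (μ * K) 1) ^ i * dist x y := by gcongr; exact le_max_left _ _
      _ ≤ (max (μ * K) 1) ^ p * dist x y := by gcongr; exact le_max_right _ _
  · simp only [averagedDist, dist_comm]
  · refine le_trans ?_ (add_le_add (le_averagedDist f μ hi x y) (le_averagedDist f μ hi y z))
    rw [← mul_add]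
    gcongr
    exact max_le ((dist_triangle _ _ _).trans (add_le_add (le_max_left _ _) (le_max_left _ _)))
      ((dist_triangle _ _ _).trans (add_le_add (le_max_right _ _) (le_max_right _ _)))

theorem pow_mul_dist_iterate_succ_le (f : M ≃ₜ M) (hμ : 0 < μ) {i : ℕ} (hi : i ≤ p) (x y : M) :
    μ ^ i * dist (f^[i + 1] x) (f^[i + 1] y) ≤ averagedDist f μ p (f x) (f y) := by
  refine le_trans ?_ (le_averagedDist f μ hi (f x) (f y))
  rw [Function.iterate_succ_apply, Function.iterate_succ_apply]
  gcongr
  exact le_max_left _ _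

/-- If the maximum is attained at an index `i + 1`, one application of `f` or `f.symm` moves that
term to index `i` and gains `μ⁻¹`. If it is attained at `0`, the term of index `p` after one step
sees the power `p + 1`, and `2 * μ ^ p = μ⁻¹`. -/
theorem averagedDist_hyperbolic (hμ : 0 < μ) (hp : μ ^ (p + 1) = 1 / 2) {c : ℝ}
    (H : ∀ x y, min (2 * dist x y) c ≤
      max (dist (f^[p + 1] x) (f^[p + 1] y)) (dist (f.symm^[p + 1] x) (f.symm^[p + 1] y)))
    (x y : M) : min (μ⁻¹ * averagedDist f μ p x y) (μ ^ p * c) ≤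
      max (averagedDist f μ p (f x) (f y)) (averagedDist f μ p (f.symm x) (f.symm y)) := by
  have hs {i : ℕ} (hi : i ≤ p) : μ ^ i * max (dist (f^[i + 1] x) (f^[i + 1] y))
      (dist (f.symm^[i + 1] x) (f.symm^[i + 1] y)) ≤
      max (averagedDist f μ p (f x) (f y)) (averagedDist f μ p (f.symm x) (f.symm y)) := by
    rw [mul_max_of_nonneg _ _ (by positivity)]
    refine max_le_max (pow_mul_dist_iterate_succ_le f hμ hi x y) ?_
    have := pow_mul_dist_iterate_succ_le f.symm hμ hi x y
    rwa [averagedDist_symm_homeo] at this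
  obtain ⟨i, hi, he⟩ := Finset.exists_mem_eq_sup' (Finset.nonempty_range_add_one (n := p)) fun i =>
    μ ^ i * max (dist (f^[i] x) (f^[i] y)) (dist (f.symm^[i] x) (f.symm^[i] y))
  rw [Finset.mem_range_succ_iff] at hi
  change averagedDist f μ p x y = _ at he
  cases i with
  | zero =>
    simp only [pow_zero, Function.iterate_zero, id, max_self, one_mul] at he
    refine le_trans (le_of_eq ?_)
      ((mul_le_mul_of_nonneg_left (H x y) (pow_pos hμ p).le).trans (hs le_rfl))
    rw [mul_min_of_nonneg _ _ (by positivity), he]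
    congr 1
    field_simp
    rw [pow_succ] at hp
    linear_combination (-2 * dist x y) * hp
  | succ i =>
    refine (min_le_left _ _).trans (le_trans (le_of_eq ?_) (hs (i := i) (by omega)))
    rw [he, pow_succ]
    field_simp

theorem exists_isHyperbolicMetric_of_iterate (hK : 0 ≤ K)
    (h1 : ∀ x y, dist (f x) (f y) ≤ K * dist x y)
    (h2 : ∀ x y, dist (f.symm x) (f.symm y) ≤ K * dist x y) {c : ℝ} (hc : 0 < c)
    (H : ∀ x y, min (2 * dist x y) c ≤
      max (dist (f^[p + 1] x) (f^[p + 1] y)) (dist (f.symm^[p + 1] x) (f.symm^[p + 1] y))) :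
    ∃ (d : M → M → ℝ) (k ε₀ : ℝ), IsHyperbolicMetric f d k ε₀ := by
  obtain ⟨μ, h0, hlt, hμ⟩ := exists_pow_eq_of_lt_one (c := 1 / 2) (by norm_num) (by norm_num)
    p.succ_ne_zero
  have hcomm : Function.Commute f f.symm := fun x => by simp
  exact ⟨averagedDist f μ p, μ⁻¹, μ ^ p * c,
    { isCompatibleMetric := isCompatibleMetric_averagedDist h0 hK h1 h2
      one_lt := (one_lt_inv₀ h0).2 hlt
      pos := by positivity
      hyperbolic := averagedDist_hyperbolic h0 hμ H
      lipschitz := ⟨K, averagedDist_map_le h0 hK (Function.Commute.refl _) hcomm h1⟩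
      lipschitz_symm := ⟨K, averagedDist_map_le h0 hK hcomm.symm (Function.Commute.refl _) h2⟩ }⟩

/-- If some power of `f` doubles small distances in the future or in the past and `f` is
bi-Lipschitz, for a compatible metric, then `f` has an adapted hyperbolic metric. -/
theorem IsCompatibleMetric.exists_isHyperbolicMetric {M : Type*} [TopologicalSpace M] {f : M ≃ₜ M}
    {D : M → M → ℝ} (hD : IsCompatibleMetric D) {K c : ℝ} {p : ℕ} (hK : 0 ≤ K)
    (h1 : ∀ x y, D (f x) (f y) ≤ K * D x y)
    (h2 : ∀ x y, D (f.symm x) (f.symm y) ≤ K * D x y) (hc : 0 < c)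
    (H : ∀ x y, min (2 * D x y) c ≤
      max (D (f^[p + 1] x) (f^[p + 1] y)) (D (f.symm^[p + 1] x) (f.symm^[p + 1] y))) :
    ∃ (d : M → M → ℝ) (k ε₀ : ℝ), IsHyperbolicMetric f d k ε₀ := by
  let := hD.toMetricSpace
  exact exists_isHyperbolicMetric_of_iterate hK h1 h2 hc H

end averaged

/-! ### The separation-time quasi-distance. -/

section separation

variable {M : Type*} [MetricSpace M] {f : M ≃ₜ M} {α b : ℝ}

/-- The orbits of `x` and `y` are `α`-separated at some time in `[-n, n]`. -/
def SeparatedWithin (f : M ≃ₜ M) (α : ℝ) (x y : M) (n : ℕ) : Prop :=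
  ∃ i : ℤ, i.natAbs ≤ n ∧ α < dist ((f ^ i) x) ((f ^ i) y)

theorem SeparatedWithin.comm {x y : M} {n : ℕ} (h : SeparatedWithin f α x y n) :
    SeparatedWithin f α y x n := by
  obtain ⟨i, hi, h⟩ := h
  exact ⟨i, hi, by rwa [dist_comm]⟩

theorem SeparatedWithin.of_zpow {x y : M} {n m : ℕ} {i : ℤ} (hi : i.natAbs ≤ m)
    (h : SeparatedWithin f α ((f ^ i) x) ((f ^ i) y) n) : SeparatedWithin f α x y (n + m) := by
  obtain ⟨j, hj, h⟩ := h
  refine ⟨j + i, by omega, ?_⟩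
  simpa only [zpow_add, Homeomorph.mul_apply] using h

theorem SeparatedWithin.ne {x y : M} {n : ℕ} (hα : 0 < α) (h : SeparatedWithin f α x y n) :
    x ≠ y := by
  rintro rfl
  obtain ⟨i, -, h⟩ := h
  rw [dist_self] at h
  exact hα.not_gt h

/-- Expansivity is uniform on compact spaces. -/
theorem exists_separatedWithin_of_le_dist [CompactSpace M]
    (hf : ∀ x y : M, x ≠ y → ∃ n : ℤ, α < dist ((f ^ n) x) ((f ^ n) y)) {η : ℝ} (hη : 0 < η) :
    ∃ m : ℕ, ∀ x y, η ≤ dist x y → SeparatedWithin f α x y m := by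
  have hK : IsCompact {z : M × M | η ≤ dist z.1 z.2} :=
    (isClosed_le continuous_const continuous_dist).isCompact
  suffices ∃ m : ℕ, {z : M × M | η ≤ dist z.1 z.2} ⊆ {z | SeparatedWithin f α z.1 z.2 m} from
    this.imp fun m hm x y h => hm (show (x, y) ∈ {z : M × M | η ≤ dist z.1 z.2} from h)
  refine hK.elim_directed_cover (fun n : ℕ => {z | SeparatedWithin f α z.1 z.2 n})
    (fun n => ?_) (fun z hz => ?_) (directed_of_isDirected_le fun a b hab z hz => ?_)
  · have : {z : M × M | SeparatedWithin f α z.1 z.2 n} =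
        ⋃ i : ℤ, ⋃ _ : i.natAbs ≤ n, {z | α < dist ((f ^ i) z.1) ((f ^ i) z.2)} := by
      ext; simp [SeparatedWithin]
    rw [this]
    refine isOpen_iUnion fun i => isOpen_iUnion fun _ => isOpen_lt continuous_const ?_
    exact ((f ^ i).continuous.comp continuous_fst).dist ((f ^ i).continuous.comp continuous_snd)
  · obtain ⟨i, hi⟩ := hf z.1 z.2 (dist_pos.1 (hη.trans_le hz))
    exact Set.mem_iUnion.2 ⟨i.natAbs, i, le_rfl, hi⟩
  · obtain ⟨i, hi, h⟩ := hz
    exact ⟨i, hi.trans hab, h⟩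

open scoped Classical in
/-- The quasi-distance `b ^ n`, where `n` is the first time at which the orbits of `x` and `y` are
`α`-separated, in the future or in the past. -/
noncomputable def separationDist (f : M ≃ₜ M) (α b : ℝ) (x y : M) : ℝ :=
  if x = y then 0 else b ^ sInf {n | SeparatedWithin f α x y n}

theorem separationDist_self (x : M) : separationDist f α b x x = 0 := by simp [separationDist]

theorem separationDist_comm (x y : M) : separationDist f α b x y = separationDist f α b y x := by
  have : {n | SeparatedWithin f α x y n} = {n | SeparatedWithin f α y x n} :=
    Set.ext fun n => ⟨SeparatedWithin.comm, SeparatedWithin.comm⟩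
  rcases eq_or_ne x y with rfl | h
  · rfl
  · rw [separationDist, separationDist, if_neg h, if_neg h.symm, this]

theorem separationDist_nonneg (hb : 0 < b) (x y : M) : 0 ≤ separationDist f α b x y := by
  unfold separationDist
  split_ifs <;> positivity

theorem SeparatedWithin.pow_le (hα : 0 < α) (h0 : 0 < b) (h1 : b < 1) {x y : M} {n : ℕ}
    (h : SeparatedWithin f α x y n) : b ^ n ≤ separationDist f α b x y := by
  rw [separationDist, if_neg (h.ne hα)]
  exact pow_le_pow_of_le_one h0.le h1.le (Nat.sInf_le h)

theorem exists_separationDist_eq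
    (hf : ∀ x y : M, x ≠ y → ∃ n : ℤ, α < dist ((f ^ n) x) ((f ^ n) y)) {x y : M} (hxy : x ≠ y) :
    ∃ i : ℤ, α < dist ((f ^ i) x) ((f ^ i) y) ∧ separationDist f α b x y = b ^ i.natAbs := by
  have hne : {n | SeparatedWithin f α x y n}.Nonempty := by
    obtain ⟨i, hi⟩ := hf x y hxy
    exact ⟨i.natAbs, i, le_rfl, hi⟩
  obtain ⟨i, hi, h⟩ := Nat.sInf_mem hne
  refine ⟨i, h, ?_⟩
  rw [separationDist, if_neg hxy, le_antisymm hi (Nat.sInf_le ⟨i, le_rfl, h⟩)]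

/-- When `x` and `z` are `α`-separated, `y` is `α / 2`-far from one of them, and uniform expansivity
separates that pair within `m` more steps. -/
theorem separationDist_quasi_triangle (hα : 0 < α) (h0 : 0 < b) (h1 : b < 1)
    (hf : ∀ x y : M, x ≠ y → ∃ n : ℤ, α < dist ((f ^ n) x) ((f ^ n) y)) {m : ℕ}
    (hm : ∀ x y, α / 2 ≤ dist x y → SeparatedWithin f α x y m) (x y z : M) :
    b ^ m * separationDist f α b x z ≤
      max (separationDist f α b x y) (separationDist f α b y z) := by
  rcases eq_or_ne x z with rfl | hxz
  · rw [separationDist_self, mul_zero]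
    exact (separationDist_nonneg h0 x y).trans (le_max_left _ _)
  obtain ⟨i, hi, he⟩ := exists_separationDist_eq (b := b) hf hxz
  rw [he, ← pow_add]
  have := dist_triangle ((f ^ i) x) ((f ^ i) y) ((f ^ i) z)
  rcases le_total (α / 2) (dist ((f ^ i) x) ((f ^ i) y)) with h | h
  · exact (((hm _ _ h).of_zpow le_rfl).pow_le hα h0 h1).trans (le_max_left _ _)
  · exact (((hm _ _ (by linarith)).of_zpow le_rfl).pow_le hα h0 h1).trans (le_max_right _ _)

theorem separationDist_zpow_le (hα : 0 < α) (h0 : 0 < b) (h1 : b < 1)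
    (hf : ∀ x y : M, x ≠ y → ∃ n : ℤ, α < dist ((f ^ n) x) ((f ^ n) y)) {j : ℤ} {n : ℕ}
    (hj : j.natAbs ≤ n) (x y : M) :
    b ^ n * separationDist f α b ((f ^ j) x) ((f ^ j) y) ≤ separationDist f α b x y := by
  rcases eq_or_ne x y with rfl | hxy
  · simp [separationDist_self]
  obtain ⟨i, hi, he⟩ := exists_separationDist_eq (b := b) hf ((f ^ j).injective.ne hxy)
  rw [he, mul_comm, ← pow_add]
  exact SeparatedWithin.pow_le hα h0 h1 (SeparatedWithin.of_zpow hj ⟨i, le_rfl, hi⟩)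

/-- After time `p`, in the future or in the past, small values of the separation quasi-distance are
multiplied by `b ^ (-p)`. -/
theorem separationDist_expand (hα : 0 < α) (h0 : 0 < b) (h1 : b < 1)
    (hf : ∀ x y : M, x ≠ y → ∃ n : ℤ, α < dist ((f ^ n) x) ((f ^ n) y)) (p : ℕ) (x y : M) :
    min ((b ^ p)⁻¹ * separationDist f α b x y) (b ^ (2 * p)) ≤
      max (separationDist f α b ((f ^ (p : ℤ)) x) ((f ^ (p : ℤ)) y))
        (separationDist f α b ((f ^ (-p : ℤ)) x) ((f ^ (-p : ℤ)) y)) := by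
  rcases eq_or_ne x y with rfl | hxy
  · simp only [separationDist_self, mul_zero, max_self]
    exact min_le_left _ _
  obtain ⟨i, hi, he⟩ := exists_separationDist_eq (b := b) hf hxy
  have hsep (j : ℤ) : SeparatedWithin f α ((f ^ j) x) ((f ^ j) y) (i - j).natAbs := by
    refine ⟨i - j, le_rfl, ?_⟩
    rwa [← Homeomorph.mul_apply, ← Homeomorph.mul_apply, ← zpow_add, sub_add_cancel]
  have hle (j : ℤ) := (hsep j).pow_le hα h0 h1
  -- If the separation time is at most `p`, the images under `f ^ p` separate within `2 * p` steps,
  -- which gives the threshold. Otherwise moving `p` steps in the direction of the sign of `i`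
  -- shortens the time by `p`.
  rcases le_total i.natAbs p with hip | hip
  · refine (min_le_right _ _).trans (le_trans ?_ (le_max_of_le_left (hle p)))
    exact pow_le_pow_of_le_one h0.le h1.le (by omega)
  · refine (min_le_left _ _).trans ?_
    have e : (b ^ p)⁻¹ * separationDist f α b x y = b ^ (i.natAbs - p) := by
      rw [he, pow_sub₀ _ h0.ne' hip, mul_comm]
    rw [e]
    rcases le_total 0 i with hi0 | hi0
    · refine le_trans (le_of_eq ?_) (le_max_of_le_left (hle p))
      congr 1; omega
    · refine le_trans (le_of_eq ?_) (le_max_of_le_right (hle (-p)))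
      congr 1; omega

end separation

/-! ### Metrization and existence of an adapted metric. -/

/-- Frink's metrization lemma: a symmetric function with the relaxed triangle inequality is
equivalent to a pseudometric. -/
theorem exists_dist_of_quasiDist {X : Type*} (ρ : X → X → ℝ) (hnn : ∀ x y, 0 ≤ ρ x y)
    (hself : ∀ x, ρ x x = 0) (hcomm : ∀ x y, ρ x y = ρ y x)
    (hρ : ∀ x₁ x₂ x₃ x₄, ρ x₁ x₄ ≤ 2 * max (ρ x₁ x₂) (max (ρ x₂ x₃) (ρ x₃ x₄))) :
    ∃ D : X → X → ℝ, (∀ x y, D x y ≤ ρ x y) ∧ (∀ x y, ρ x y ≤ 2 * D x y) ∧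
      (∀ x y, D x y = D y x) ∧ ∀ x y z, D x z ≤ D x y + D y z := by
  let d : X → X → NNReal := fun x y => ⟨ρ x y, hnn x y⟩
  have h1 : ∀ x, d x x = 0 := fun x => NNReal.eq (hself x)
  have h2 : ∀ x y, d x y = d y x := fun x y => NNReal.eq (hcomm x y)
  have h3 : ∀ x₁ x₂ x₃ x₄, d x₁ x₄ ≤ 2 * max (d x₁ x₂) (max (d x₂ x₃) (d x₃ x₄)) :=
    fun x₁ x₂ x₃ x₄ => by
      rw [← NNReal.coe_le_coe]
      push_cast
      exact hρ x₁ x₂ x₃ x₄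
  let := PseudoMetricSpace.ofPreNNDist d h1 h2
  exact ⟨dist, PseudoMetricSpace.dist_ofPreNNDist_le d h1 h2,
    PseudoMetricSpace.le_two_mul_dist_ofPreNNDist d h1 h2 h3, dist_comm, dist_triangle⟩

/-- A metric equivalent to the separation quasi-distance of an expansive homeomorphism of a compact
space defines its topology. -/
theorem isCompatibleMetric_of_separationDist {M : Type*} [MetricSpace M] [CompactSpace M]
    {f : M ≃ₜ M} {α b : ℝ} (hα : 0 < α) (h0 : 0 < b) (h1 : b < 1)
    (hf : ∀ x y : M, x ≠ y → ∃ n : ℤ, α < dist ((f ^ n) x) ((f ^ n) y)) {D : M → M → ℝ}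
    (hD1 : ∀ x y, D x y ≤ separationDist f α b x y)
    (hD2 : ∀ x y, separationDist f α b x y ≤ 2 * D x y) (hsymm : ∀ x y, D x y = D y x)
    (htri : ∀ x y z, D x z ≤ D x y + D y z) : IsCompatibleMetric D where
  eq_zero_iff x y := by
    constructor
    · intro h
      by_contra hxy
      obtain ⟨i, -, he⟩ := exists_separationDist_eq (b := b) hf hxy
      have h3 := hD2 x y
      have : 0 < b ^ i.natAbs := by positivity
      linarith
    · rintro rfl
      have h3 := hD1 x x
      have h4 := hD2 x x
      rw [separationDist_self] at h3 h4
      linarith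
  symm := hsymm
  triangle := htri
  isOpen_iff s := by
    constructor
    · intro hs x hx
      obtain ⟨η, hη, h⟩ := Metric.isOpen_iff.1 hs x hx
      obtain ⟨m, hm⟩ := exists_separatedWithin_of_le_dist hf hη
      refine ⟨b ^ m / 2, by positivity, fun y hy => h ?_⟩
      rw [Metric.mem_ball']
      by_contra! hle
      linarith [(hm x y hle).pow_le hα h0 h1, hD2 x y]
    · intro h
      rw [isOpen_iff_mem_nhds]
      intro x hx
      obtain ⟨r, hr, h⟩ := h x hx
      obtain ⟨m, hm⟩ := exists_pow_lt_of_lt_one hr h1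
      have hev : ∀ᶠ y in 𝓝 x, ∀ i ∈ Finset.Icc (-m : ℤ) m, dist ((f ^ i) x) ((f ^ i) y) < α := by
        refine (eventually_all_finset _).2 fun i _ => ?_
        have hc : Continuous fun y => dist ((f ^ i) x) ((f ^ i) y) :=
          continuous_const.dist (f ^ i).continuous
        refine hc.continuousAt.eventually_lt continuousAt_const ?_
        simpa using hα
      filter_upwards [hev] with y hy
      refine h y ((hD1 x y).trans_lt ?_)
      rcases eq_or_ne x y with rfl | hxy
      · rwa [separationDist_self]
      obtain ⟨i, hi, he⟩ := exists_separationDist_eq (b := b) hf hxy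
      rw [he]
      refine lt_of_le_of_lt (pow_le_pow_of_le_one h0.le h1.le ?_) hm
      by_contra! hlt
      exact lt_asymm hi (hy i (Finset.mem_Icc.2 ⟨by omega, by omega⟩))

/-- An expansive homeomorphism of a compact metric space has an adapted hyperbolic metric. -/
theorem IsExpansive.exists_isHyperbolicMetric {M : Type*} [MetricSpace M] [CompactSpace M]
    {f : M ≃ₜ M} (hf : IsExpansive f) :
    ∃ (d : M → M → ℝ) (k ε₀ : ℝ), IsHyperbolicMetric f d k ε₀ := by
  obtain ⟨α, hα, hf⟩ := hf
  obtain ⟨m, hm⟩ := exists_separatedWithin_of_le_dist hf (half_pos hα)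
  -- Two quasi-triangle inequalities cost `b ^ (-2 * m)`, at most the factor `2` of Frink's lemma
  -- when `b ^ (2 * m + 1) = 1 / 2`; the extra `1` keeps the root meaningful for `m = 0`.
  obtain ⟨b, h0, h1, hb⟩ := exists_pow_eq_of_lt_one (c := 1 / 2) (by norm_num) (by norm_num)
    (2 * m).succ_ne_zero
  have hb2 : 1 / 2 ≤ b ^ m * b ^ m := by
    rw [← hb, ← pow_add]
    exact pow_le_pow_of_le_one h0.le h1.le (by omega)
  let ρ := separationDist f α b
  have hnn : ∀ x y, 0 ≤ ρ x y := separationDist_nonneg h0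
  have htri := separationDist_quasi_triangle hα h0 h1 hf hm
  obtain ⟨D, hD1, hD2, hD3, hD4⟩ := exists_dist_of_quasiDist ρ hnn
    separationDist_self separationDist_comm (fun x₁ x₂ x₃ x₄ => by
      have t1 : b ^ m * ρ x₁ x₄ ≤ max (ρ x₁ x₂) (ρ x₂ x₄) := htri x₁ x₂ x₄
      have t2 : b ^ m * ρ x₂ x₄ ≤ max (ρ x₂ x₃) (ρ x₃ x₄) := htri x₂ x₃ x₄
      have hbm : b ^ m ≤ 1 := pow_le_one₀ h0.le h1.le
      have hbm0 : 0 < b ^ m := by positivity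
      have t3 : b ^ m * (b ^ m * ρ x₁ x₄) ≤ max (ρ x₁ x₂) (max (ρ x₂ x₃) (ρ x₃ x₄)) := by
        refine (mul_le_mul_of_nonneg_left t1 hbm0.le).trans ?_
        rw [mul_max_of_nonneg _ _ hbm0.le]
        refine max_le_max ?_ t2
        exact mul_le_of_le_one_left (hnn _ _) hbm
      nlinarith [hnn x₁ x₄])
  have hcompat := isCompatibleMetric_of_separationDist hα h0 h1 hf hD1 hD2 hD3 hD4
  have hlip (j : ℤ) (hj : j.natAbs ≤ 1) (x y : M) :
      D ((f ^ j) x) ((f ^ j) y) ≤ 2 * b⁻¹ * D x y := by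
    have t := separationDist_zpow_le hα h0 h1 hf hj x y
    rw [pow_one, ← le_inv_mul_iff₀ h0] at t
    calc _ ≤ _ := (hD1 _ _).trans t
      _ ≤ b⁻¹ * (2 * D x y) := by gcongr; exact hD2 x y
      _ = _ := by ring
  -- The quasi-distance must expand by `4`, since passing to `D` loses a factor `2`; the threshold
  -- is halved for the same reason.
  obtain ⟨p, hp⟩ := exists_pow_lt_of_lt_one (show (0 : ℝ) < 1 / 4 by norm_num) h1
  have hp' : b ^ (p + 1) ≤ 1 / 4 :=
    (pow_le_pow_of_le_one h0.le h1.le p.le_succ).trans hp.le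
  have hinv : 4 ≤ (b ^ (p + 1))⁻¹ := by
    rw [le_inv_comm₀ (by norm_num) (by positivity)]
    linarith
  have hit (n : ℕ) (x : M) : (f ^ (n : ℤ)) x = f^[n] x := by
    rw [zpow_natCast, f.pow_apply_eq_iterate]
  have hit' (n : ℕ) (x : M) : (f ^ (-n : ℤ)) x = f.symm^[n] x := by
    rw [zpow_neg, ← inv_zpow, zpow_natCast]
    exact f.symm.pow_apply_eq_iterate n x
  refine hcompat.exists_isHyperbolicMetric (K := 2 * b⁻¹) (p := p)
    (c := b ^ (2 * (p + 1)) / 2) (by positivity) (hlip 1 (by simp)) (fun x y => ?_) (by positivity)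
    (fun x y => ?_)
  · exact hlip (-1) (by simp) x y
  · have t := separationDist_expand hα h0 h1 hf (p + 1) x y
    rw [hit, hit, hit', hit'] at t
    have t1 := hD2 (f^[p + 1] x) (f^[p + 1] y)
    have t2 := hD2 (f.symm^[p + 1] x) (f.symm^[p + 1] y)
    have t3 := hD1 x y
    have t4 : 4 * D x y ≤ (b ^ (p + 1))⁻¹ * ρ x y :=
      mul_le_mul hinv t3 (by linarith [hD2 x y, hnn x y]) (by positivity)
    have t5 := (min_le_min_right (b ^ (2 * (p + 1))) t4).trans (t.trans (max_le_max t1 t2))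
    rw [← mul_max_of_nonneg _ _ (by norm_num)] at t5
    rcases min_le_iff.1 t5 with h | h
    · exact (min_le_left _ _).trans (by linarith)
    · exact (min_le_right _ _).trans (by linarith)

theorem theorem2p5 {M : Type*} [MetricSpace M] [CompactSpace M] [ConnectedSpace M]
    [LocallyConnectedSpace M] [Nontrivial M] (f : M ≃ₜ M) (hf : IsExpansive f) :
    (∃ (d : M → M → ℝ) (k ε₀ : ℝ), IsHyperbolicMetric f d k ε₀) ∧
    ∀ (d : M → M → ℝ) (k ε₀ : ℝ), IsHyperbolicMetric f d k ε₀ →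
      ∀ x : M, ∃ L l : ℝ,
        LyapunovExponent.HasMaxExponent f d x L ∧ LyapunovExponent.HasMinExponent f d x l ∧
        Real.log k ≤ L ∧ l ≤ -Real.log k :=
  ⟨hf.exists_isHyperbolicMetric, fun _ _ _ H x => H.exists_exponents x⟩
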